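/- Let $\Sigma^n$ be a smooth $n$-dimensional manifold without boundary, smoothly immersed in $\mathbf C^n$ (equipped with its Euclidean metric $\langle\cdot,\cdot\rangle$, the complex structure $J$ given by multiplication by $i$, and the symplectic form $\bar\omega(v,w)=\langle Jv,w\rangle$). Let $v^T$ and $v^\perp$ be the tangential and normal parts of a vector $v$, let $A(u,w)=(D_uW)^\perp$ ($W$ a tangent field extending $w$) be the second fundamental form, and let $H=\operatorname{tr}A$ be the mean curvature vector. Suppose that $\Sigma$ is a Lagrangian translating soliton, i.e. $\bar\omega$ restricts to zero on $\Sigma$ and $H=T^\perp$ for a constant vector $T\in\mathbf C^n$. For normal vector fields $V$ and functions $f$ on $\Sigma$ put $$LV=\Delta^\perp V+\nabla^\perp_{T^T}V+\sum_{i,j}\langle A(e_i,e_j),V\rangle A(e_i,e_j),\qquad \mathcal Lf=\Delta f+\langle T,\nabla f\rangle,$$ where $\nabla^\perp$ and $\Delta^\perp$ are the connection and the Laplacian of the normal bundle, $\nabla$ and $\Delta$ are the gradient and the Laplace–Beltrami operator of the induced metric, and $(e_i)$ is an orthonormal basis of the tangent space. Then for every function $f$ of class $C^3$ on $\Sigma$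 (in particular for every smooth $f$), $$L(J\nabla f)=J\nabla(\mathcal Lf).$$ Moreover, the set of Hamiltonian variations, that is, the vector space of smooth normal vector fields $V$ along $\Sigma$ for which the one-form $u\mapsto\bar\omega(V,u)$ on $\Sigma$ is exact (equal to $dh$ for a smooth function $h$ on $\Sigma$), is an invariant subspace of $L$: if $V$ is a Hamiltonian variation, then so is $LV$. -/

import Mathlib

open scoped Manifold ContDiff

/-! Extrinsic geometry of an immersed `n`-dimensional submanifold `x : M → E` of a Euclidean space
`E`, and the Lagrangian case `E = ℂⁿ`. Tangent vectors of the submanifold are identified with their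
images in `E` under `dx`; vector fields along the immersion are maps `M → E`. -/

namespace Soliton

noncomputable section

/-- A smooth immersion `x : M → E` of an `n`-dimensional manifold into a real inner product space,
i.e. an immersed submanifold `Σ` of `E` (an embedded submanifold is the case of an inclusion). -/
structure Immersion (n : ℕ) (M : Type*) [TopologicalSpace M]
    [ChartedSpace (EuclideanSpace ℝ (Fin n)) M]
    (E : Type*) [NormedAddCommGroup E] [InnerProductSpace ℝ E] where
  toFun : M → E
  smooth : ContMDiff (𝓡 n) 𝓘(ℝ, E) ∞ toFun
  injective_mfderiv : ∀ p, Function.Injective (mfderiv (𝓡 n) 𝓘(ℝ, E) toFun p)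

variable {n : ℕ} {M : Type*} [TopologicalSpace M] [ChartedSpace (EuclideanSpace ℝ (Fin n)) M]
  {E : Type*} [NormedAddCommGroup E] [InnerProductSpace ℝ E]

/-- The differential `dV_p : T_pM → F` of a vector-valued function `V` on `M`. -/
def dmap {F : Type*} [NormedAddCommGroup F] [NormedSpace ℝ F] (V : M → F) (p : M) :
    TangentSpace (𝓡 n) p →L[ℝ] F :=
  mfderiv (𝓡 n) 𝓘(ℝ, F) V p

/-- The differential `dx_p : T_pM → E` of the immersion. -/
def differential (x : Immersion n M E) (p : M) : TangentSpace (𝓡 n) p →L[ℝ] E :=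
  dmap x.toFun p

/-- The tangent space of the immersed submanifold at `p`, i.e. the subspace `dx_p(T_pM)` of `E`. -/
def tangentSpace (x : Immersion n M E) (p : M) : Submodule ℝ E :=
  LinearMap.range (differential x p).toLinearMap

instance finiteDimensional_tangentSpace (x : Immersion n M E) (p : M) : FiniteDimensional ℝ (tangentSpace x p) :=
  haveI : FiniteDimensional ℝ (TangentSpace (𝓡 n) p) :=
    inferInstanceAs (FiniteDimensional ℝ (EuclideanSpace ℝ (Fin n)))
  inferInstanceAs (FiniteDimensional ℝ (LinearMap.range (differential x p).toLinearMap))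

/-- The intrinsic tangent vector at `p` represented by `u ∈ dx_p(T_pM)`, i.e. `dx_p⁻¹(u)`. -/
def toIntrinsic (x : Immersion n M E) (p : M) (u : tangentSpace x p) : TangentSpace (𝓡 n) p :=
  (LinearMap.mem_range.mp u.2).choose

/-- The tangential part `v^⊤` of a vector `v` of `E` at the point `p`. -/
def tangential (x : Immersion n M E) (p : M) (v : E) : tangentSpace x p :=
  (tangentSpace x p).orthogonalProjectionOnto v

/-- The normal part `v^⊥` of a vector `v` of `E` at the point `p`. -/
def normalPart (x : Immersion n M E) (p : M) (v : E) : E :=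
  v - (tangential x p v : E)

/-- `D_u V`: the derivative at `p` (flat connection of `E`) of a vector field `V` along `x`,
in the direction of the tangent vector `u`. -/
def ambientDeriv (x : Immersion n M E) (V : M → E) (p : M) (u : tangentSpace x p) : E :=
  dmap V p (toIntrinsic x p u)

/-- The Levi-Civita connection of the induced metric: `∇_u W = (D_u W)^⊤`, for a tangent vector
field `W` along `x`. -/
def tangentConn (x : Immersion n M E) (W : M → E) (p : M) (u : tangentSpace x p) :
    tangentSpace x p :=
  tangential x p (ambientDeriv x W p u)

/-- The normal connection: `∇^⊥_u V = (D_u V)^⊥`, for a normal vector field `V` along `x`. -/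
def normalConn (x : Immersion n M E) (V : M → E) (p : M) (u : tangentSpace x p) : E :=
  normalPart x p (ambientDeriv x V p u)

/-- An extension of the tangent vector `w` at `p` to a tangent vector field along `x`, used to
evaluate tensorial expressions, which do not depend on the extension. -/
def extend (x : Immersion n M E) {p : M} (w : tangentSpace x p) (q : M) : tangentSpace x q :=
  tangential x q (w : E)

/-- The second fundamental form `A(u, w) = (D_u W)^⊥`, where the tangent field `W` extends `w`. -/
def secondFF (x : Immersion n M E) (p : M) (u w : tangentSpace x p) : E :=
  normalPart x p (ambientDeriv x (fun q => (extend x w q : E)) p u)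

/-- An orthonormal basis `e_i` of the tangent space of the immersed submanifold at `p`. -/
def frame (x : Immersion n M E) (p : M) :
    OrthonormalBasis (Fin (Module.finrank ℝ (tangentSpace x p))) ℝ (tangentSpace x p) :=
  stdOrthonormalBasis ℝ (tangentSpace x p)

/-- The mean curvature vector `H = ∑ A(e_i, e_i)`, the trace of the second fundamental form. -/
def meanCurvature (x : Immersion n M E) (p : M) : E :=
  ∑ i, secondFF x p (frame x p i) (frame x p i)

/-- The second covariant derivative in the normal bundle,
`(∇^⊥)²_{u,w} V = ∇^⊥_u (∇^⊥_W V) - ∇^⊥_{∇_u W} V`, where the tangent field `W` extends `w`. -/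
def normalHessian (x : Immersion n M E) (V : M → E) (p : M) (u w : tangentSpace x p) : E :=
  normalConn x (fun q => normalConn x V q (extend x w q)) p u
    - normalConn x V p (tangentConn x (fun q => (extend x w q : E)) p u)

/-- The Laplacian of the normal bundle, `Δ^⊥ V = ∑ (∇^⊥)²_{e_i,e_i} V`. -/
def normalLaplacian (x : Immersion n M E) (V : M → E) (p : M) : E :=
  ∑ i, normalHessian x V p (frame x p i) (frame x p i)

/-- The stability operator on normal vector fields,
`LV = Δ^⊥ V + ∇^⊥_{T^⊤} V + ⟨⟨A, V⟩, A⟩`, where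
`⟨⟨A, V⟩, A⟩ = ∑_{i,j} ⟨A(e_i, e_j), V⟩ A(e_i, e_j)`. -/
def stabilityOp (x : Immersion n M E) (T : E) (V : M → E) (p : M) : E :=
  normalLaplacian x V p + normalConn x V p (tangential x p T)
    + ∑ i, ∑ j, (inner ℝ (secondFF x p (frame x p i) (frame x p j)) (V p)) •
        secondFF x p (frame x p i) (frame x p j)

/-- The gradient of a function for the induced metric, `∇f = ∑ df(e_i) e_i`. -/
def grad (x : Immersion n M E) (f : M → ℝ) (p : M) : tangentSpace x p :=
  ∑ i, dmap f p (toIntrinsic x p (frame x p i)) • frame x p i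

/-- The Laplace-Beltrami operator of the induced metric, `Δf = div ∇f = ∑ ⟨∇_{e_i} ∇f, e_i⟩`. -/
def laplacian (x : Immersion n M E) (f : M → ℝ) (p : M) : ℝ :=
  ∑ i, inner ℝ (tangentConn x (fun q => (grad x f q : E)) p (frame x p i)) (frame x p i)

/-- The drift Laplacian `𝓛f = Δf + ⟨T, ∇f⟩`. -/
def driftLaplacian (x : Immersion n M E) (T : E) (f : M → ℝ) (p : M) : ℝ :=
  laplacian x f p + inner ℝ T (grad x f p : E)

/-- The translating soliton equation `H = T^⊥` for the constant vector `T`. -/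
def IsTranslatingSoliton (x : Immersion n M E) (T : E) : Prop :=
  ∀ p, meanCurvature x p = normalPart x p T

/-- The standard symplectic form `ω(v, w) = ⟪Jv, w⟫` of `ℂⁿ`, where `J` is multiplication by `i` and
`⟪v, w⟫ = Re ∑ conj(v_k) w_k` is the Euclidean metric of `ℂⁿ = ℝ²ⁿ`. -/
def symplecticForm (v w : EuclideanSpace ℂ (Fin n)) : ℝ :=
  inner ℝ (Complex.I • v) w

/-- The `n`-dimensional immersed submanifold of `ℂⁿ` is Lagrangian: `x^*ω = 0`. -/
def IsLagrangian (x : Immersion n M (EuclideanSpace ℂ (Fin n))) : Prop :=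
  ∀ p, ∀ u w : TangentSpace (𝓡 n) p, symplecticForm (differential x p u) (differential x p w) = 0

/-- The vector field `J∇f` along `x`. -/
def JGrad (x : Immersion n M (EuclideanSpace ℂ (Fin n))) (f : M → ℝ) (p : M) :
    EuclideanSpace ℂ (Fin n) :=
  Complex.I • (grad x f p : EuclideanSpace ℂ (Fin n))

/-- The vector field `V` along `x` is a Hamiltonian variation: the one-form `x^*(V ⌟ ω)`,
i.e. `u ↦ ω(V, dx u)`, is exact. -/
def IsHamiltonianVariation (x : Immersion n M (EuclideanSpace ℂ (Fin n)))
    (V : M → EuclideanSpace ℂ (Fin n)) : Prop :=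
  ∃ f : M → ℝ, ContMDiff (𝓡 n) 𝓘(ℝ, ℝ) ∞ f ∧
    ∀ p, ∀ u : TangentSpace (𝓡 n) p, symplecticForm (V p) (differential x p u) = dmap f p u

/-- The real vector space of smooth normal Hamiltonian variations. -/
def hamiltonianVariations (x : Immersion n M (EuclideanSpace ℂ (Fin n))) :
    Submodule ℝ (M → EuclideanSpace ℂ (Fin n)) where
  carrier := {V | ContMDiff (𝓡 n) 𝓘(ℝ, EuclideanSpace ℂ (Fin n)) ∞ V ∧
    (∀ p, V p ∈ (tangentSpace x p)ᗮ) ∧ IsHamiltonianVariation x V}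
  zero_mem' := by
    refine ⟨contMDiff_const, fun p => Submodule.zero_mem _, 0, contMDiff_const, fun p u => ?_⟩
    have h : dmap (n := n) (0 : M → ℝ) p = 0 := mfderiv_const
    rw [h]
    simp [symplecticForm]
  add_mem' := by
    rintro V W ⟨hV, hVn, f, hf, hfV⟩ ⟨hW, hWn, g, hg, hgW⟩
    refine ⟨hV.add hW, fun p => Submodule.add_mem _ (hVn p) (hWn p), f + g, hf.add hg,
      fun p u => ?_⟩
    have h : dmap (n := n) (f + g) p = dmap f p + dmap g p :=
      mfderiv_add ((hf p).mdifferentiableAt (by simp)) ((hg p).mdifferentiableAt (by simp))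
    rw [h, add_apply, ← hfV, ← hgW]
    simp [symplecticForm, smul_add, inner_add_left]
  smul_mem' := by
    rintro c V ⟨hV, hVn, f, hf, hfV⟩
    refine ⟨(c • ContinuousLinearMap.id ℝ (EuclideanSpace ℂ (Fin n))).contMDiff.comp hV,
      fun p => Submodule.smul_mem _ c (hVn p), c • f,
      (c • ContinuousLinearMap.id ℝ ℝ).contMDiff.comp hf, fun p u => ?_⟩
    have h : dmap (n := n) (c • f) p = c • dmap f p :=
      const_smul_mfderiv ((hf p).mdifferentiableAt (by simp)) c
    rw [h, smul_apply, ← hfV]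
    simp only [symplecticForm, Pi.smul_apply]
    rw [smul_comm, inner_smul_left]
    simp

end

end Soliton

/-! Everything is computed with Fréchet derivatives in the flat ambient space. Near a point, let `P`
extend the field of tangential projections and let `G` extend `∇f`. On tangent vectors `A(u,w) =
(D_u P) w`, and the Hessian of `f` is the endomorphism `K = P ∘ DG ∘ P` (`covDeriv`). The Lagrangian
condition says that `J` exchanges tangent and normal spaces, i.e. `P J = J (1 - P)`. Hence `J`
carries the tangential connection to the normal one, and `D_u P` anticommutes with `J` for tangent
`u`. Consequently `L(J∇f)` is `J` of the tangential part of `∑ (D_{e_i} K) e_i + D_{T^⊤} G + ∑ J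
A(e_i, J A(e_i, ∇f))` (`stabilityOp_JGrad`). Paired with a tangent vector `w`, the first sum is
given by `bochner`: `d(Δf)(w) + ⟨A(w,∇f), H⟩ - ∑ ⟨A(e_i,∇f), A(e_i,w)⟩`. The last sum cancels
against the quadratic term of `L`. With `H = T^⊥`, the curvature term `⟨A(w,∇f), H⟩` and the drift
term add up to `w⟨T,∇f⟩`, because the Hessian is symmetric. What remains is `d(𝓛f)(w)`. Invariance
follows since the Hamiltonian variations are exactly the fields `J∇f` with `f` smooth. -/

open Filter Topology

namespace Soliton

/-! ### Extending functions on the submanifold to the ambient space -/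

section LocalExtension

variable {n : ℕ} {M : Type*} [TopologicalSpace M] [ChartedSpace (EuclideanSpace ℝ (Fin n)) M]
  {E : Type*} [NormedAddCommGroup E] [InnerProductSpace ℝ E]
  {F : Type*} [NormedAddCommGroup F] [NormedSpace ℝ F]

/-- An immersion has a smooth local left inverse defined on the ambient space. -/
theorem exists_local_leftInverse [FiniteDimensional ℝ E] [IsManifold (𝓡 n) ∞ M]
    (x : Immersion n M E) (p : M) :
    ∃ s : E → M, ContMDiffAt 𝓘(ℝ, E) (𝓡 n) ∞ s (x.toFun p) ∧
      ∀ᶠ q in 𝓝 p, s (x.toFun q) = q := by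
  set φ := extChartAt (𝓡 n) p with hφ
  have htarget : φ.target ∈ 𝓝 (φ p) := extChartAt_target_mem_nhds p
  have hsymm : ContMDiffAt 𝓘(ℝ, EuclideanSpace ℝ (Fin n)) (𝓡 n) ∞ φ.symm (φ p) :=
    (contMDiffOn_extChartAt_symm p).contMDiffAt htarget
  have hX : ContDiffAt ℝ ∞ (x.toFun ∘ φ.symm) (φ p) := by
    rw [← contMDiffAt_iff_contDiffAt]
    exact (x.smooth _).comp _ hsymm
  have hderiv : mfderiv (𝓡 n) 𝓘(ℝ, E) x.toFun p = fderiv ℝ (x.toFun ∘ φ.symm) (φ p) := by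
    have h := ((x.smooth p).mdifferentiableAt (by simp)).mfderiv
    simp only [writtenInExtChartAt, extChartAt_model_space_eq_id, modelWithCornersSelf_coe,
      Set.range_id, fderivWithin_univ] at h
    exact h
  have hinj := x.injective_mfderiv p
  rw [hderiv] at hinj
  obtain ⟨l, hl⟩ := (fderiv ℝ (x.toFun ∘ φ.symm) (φ p)).toLinearMap.exists_leftInverse_of_injective
    (LinearMap.ker_eq_bot.mpr hinj)
  set L : E →L[ℝ] EuclideanSpace ℝ (Fin n) := LinearMap.toContinuousLinearMap l with hL
  -- A linear left inverse `L` of the differential makes `L ∘ x ∘ φ⁻¹` have derivative the identity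
  -- at `φ p`, so the inverse function theorem applies in the chart.
  have hg : ContDiffAt ℝ ∞ (L ∘ (x.toFun ∘ φ.symm)) (φ p) := L.contDiff.contDiffAt.comp _ hX
  have hg' : HasFDerivAt (L ∘ (x.toFun ∘ φ.symm))
      ((ContinuousLinearEquiv.refl ℝ (EuclideanSpace ℝ (Fin n)) :
        EuclideanSpace ℝ (Fin n) →L[ℝ] EuclideanSpace ℝ (Fin n))) (φ p) := by
    have h := L.hasFDerivAt.comp (φ p) (hX.differentiableAt (by simp)).hasFDerivAt
    exact h.congr_fderiv (ContinuousLinearMap.ext fun v => LinearMap.congr_fun hl v)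
  have hp : φ.symm (φ p) = p := extChartAt_to_inv p
  refine ⟨φ.symm ∘ hg.localInverse hg' (by simp) ∘ L, ?_, ?_⟩
  · have h1 := hg.to_localInverse hg' (by simp)
    have h2 := hg.localInverse_apply_image hg' (by simp)
    simp only [Function.comp_apply, hp] at h1 h2
    refine ContMDiffAt.comp _ ?_ ((h1.comp _ L.contDiff.contDiffAt).contMDiffAt)
    simp only [Function.comp_apply, h2]
    exact hsymm
  · have h1 := (hg.hasStrictFDerivAt' hg' (by simp)).eventually_left_inverse
    have h2 : Tendsto φ (𝓝 p) (𝓝 (φ p)) := continuousAt_extChartAt p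
    filter_upwards [h2.eventually h1, extChartAt_source_mem_nhds (I := 𝓡 n) p] with q hq hqs
    have h3 : φ.symm (φ q) = q := φ.left_inv hqs
    simp only [Function.comp_apply, h3] at hq ⊢
    change φ.symm ((hg.hasStrictFDerivAt' hg' (by simp)).localInverse _ _ _ (L (x.toFun q))) = q
    rw [hq, h3]

theorem exists_local_extension [FiniteDimensional ℝ E] [IsManifold (𝓡 n) ∞ M]
    (x : Immersion n M E) {k : ℕ∞} {f : M → F} {p : M}
    (hf : ContMDiffAt (𝓡 n) 𝓘(ℝ, F) k f p) :
    ∃ g : E → F, ContDiffAt ℝ k g (x.toFun p) ∧ ∀ᶠ q in 𝓝 p, f q = g (x.toFun q) := by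
  obtain ⟨s, hs, hsx⟩ := exists_local_leftInverse x p
  refine ⟨f ∘ s, ?_, ?_⟩
  · rw [← contMDiffAt_iff_contDiffAt]
    exact ContMDiffAt.comp_of_eq hf (hs.of_le (by exact_mod_cast le_top)) hsx.self_of_nhds
  · filter_upwards [hsx] with q hq
    simp [hq]

theorem tangentSpace_differential (x : Immersion n M E) (p : M) (v : TangentSpace (𝓡 n) p) :
    differential x p v ∈ tangentSpace x p :=
  ⟨v, rfl⟩

theorem differential_toIntrinsic (x : Immersion n M E) (p : M) (u : tangentSpace x p) :
    differential x p (toIntrinsic x p u) = u :=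
  (LinearMap.mem_range.mp u.2).choose_spec

theorem dmap_eq_fderiv_differential (x : Immersion n M E) {V : M → F} {g : E → F} {p : M}
    (hV : ∀ᶠ q in 𝓝 p, V q = g (x.toFun q)) (hg : DifferentiableAt ℝ g (x.toFun p))
    (v : TangentSpace (𝓡 n) p) :
    dmap V p v = fderiv ℝ g (x.toFun p) (differential x p v) := by
  have h1 : V =ᶠ[𝓝 p] g ∘ x.toFun := hV
  have h2 := mfderiv_comp_apply p (I := 𝓡 n) (I' := 𝓘(ℝ, E)) (I'' := 𝓘(ℝ, F))
    hg.mdifferentiableAt ((x.smooth p).mdifferentiableAt (by simp)) v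
  rw [mfderiv_eq_fderiv] at h2
  unfold dmap
  rw [h1.mfderiv_eq]
  exact h2

theorem dmap_toIntrinsic (x : Immersion n M E) {V : M → F} {g : E → F} {p : M}
    (hV : ∀ᶠ q in 𝓝 p, V q = g (x.toFun q)) (hg : DifferentiableAt ℝ g (x.toFun p))
    (u : tangentSpace x p) :
    dmap V p (toIntrinsic x p u) = fderiv ℝ g (x.toFun p) u := by
  rw [dmap_eq_fderiv_differential x hV hg, differential_toIntrinsic]

/-- Along the submanifold, tangential derivatives only depend on values on the submanifold. -/
theorem fderiv_eq_of_eventually_eq (x : Immersion n M E) {g h : E → F} {p : M}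
    (hgh : ∀ᶠ q in 𝓝 p, g (x.toFun q) = h (x.toFun q)) (hg : DifferentiableAt ℝ g (x.toFun p))
    (hh : DifferentiableAt ℝ h (x.toFun p)) {u : E} (hu : u ∈ tangentSpace x p) :
    fderiv ℝ g (x.toFun p) u = fderiv ℝ h (x.toFun p) u := by
  obtain ⟨v, rfl⟩ := hu
  have h1 := dmap_eq_fderiv_differential x (V := g ∘ x.toFun) (Eventually.of_forall fun _ => rfl)
    hg v
  have h2 := dmap_eq_fderiv_differential x (V := g ∘ x.toFun) hgh hh v
  exact h1.symm.trans h2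

theorem eventually_contDiffAt (x : Immersion n M E) {k : ℕ} {g : E → F} {p : M}
    (hg : ContDiffAt ℝ k g (x.toFun p)) : ∀ᶠ q in 𝓝 p, ContDiffAt ℝ k g (x.toFun q) :=
  (x.smooth.continuous.tendsto p).eventually (hg.eventually (by simp))

end LocalExtension

/-! ### Orthogonal projections as smooth functions of oblique ones -/

section Projection

variable {E : Type*} [NormedAddCommGroup E] [InnerProductSpace ℝ E] [FiniteDimensional ℝ E]

/-- `B - B*` is skew, so `⟨(1 + B - B*) v, v⟩ = ‖v‖²` and the kernel is trivial; finite dimension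
does the rest. -/
theorem isUnit_one_add_sub_adjoint (B : E →L[ℝ] E) :
    IsUnit (1 + B - ContinuousLinearMap.adjoint B) := by
  have hinj : Function.Injective (1 + B - ContinuousLinearMap.adjoint B : E →L[ℝ] E) := by
    rw [injective_iff_map_eq_zero]
    intro v hv
    have h : inner ℝ ((1 + B - ContinuousLinearMap.adjoint B : E →L[ℝ] E) v) v = inner ℝ v v := by
      simp only [sub_apply, add_apply, one_apply_eq_self, inner_sub_left,
        inner_add_left, ContinuousLinearMap.adjoint_inner_left, real_inner_comm v (B v)]
      ring
    rw [hv, inner_zero_left] at h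
    exact inner_self_eq_zero.mp h.symm
  rw [ContinuousLinearMap.isUnit_iff_bijective]
  exact ⟨hinj, LinearMap.injective_iff_surjective (f := (1 + B -
    ContinuousLinearMap.adjoint B : E →L[ℝ] E).toLinearMap) |>.mp hinj⟩

/-- The orthogonal projection onto the range of an oblique projection `B`. -/
theorem starProjection_eq_mul_inverse {U : Submodule ℝ E} {B : E →L[ℝ] E} (hBU : ∀ v, B v ∈ U)
    (hB : ∀ u ∈ U, B u = u) :
    B * Ring.inverse (1 + B - ContinuousLinearMap.adjoint B) = U.starProjection := by
  -- With `π` the orthogonal projection, `π B = B`, and `π B* = π` is the adjoint of `B π = π`;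
  -- hence `π (1 + B - B*) = B`.
  have h : U.starProjection * (1 + B - ContinuousLinearMap.adjoint B) = B := by
    have h1 : U.starProjection * B = B := by
      ext v
      exact Submodule.starProjection_eq_self_iff.mpr (hBU v)
    have h2 : U.starProjection * ContinuousLinearMap.adjoint B = U.starProjection := by
      ext v
      refine ext_inner_right ℝ fun w => ?_
      simp only [mul_apply_eq_comp]
      rw [Submodule.inner_starProjection_left_eq_right, ContinuousLinearMap.adjoint_inner_left,
        hB _ (Submodule.starProjection_apply_mem _ _),
        Submodule.inner_starProjection_left_eq_right]
    rw [mul_sub, mul_add, mul_one, h1, h2]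
    abel
  calc B * Ring.inverse (1 + B - ContinuousLinearMap.adjoint B)
      = U.starProjection * (1 + B - ContinuousLinearMap.adjoint B)
          * Ring.inverse (1 + B - ContinuousLinearMap.adjoint B) := by rw [h]
    _ = U.starProjection := by
      rw [mul_assoc, Ring.mul_inverse_cancel _ (isUnit_one_add_sub_adjoint B), mul_one]

theorem contDiff_adjoint {k : WithTop ℕ∞} :
    ContDiff ℝ k (fun B : E →L[ℝ] E => ContinuousLinearMap.adjoint B) :=
  (LinearMap.toContinuousLinearMap
    ({ toFun := fun B => ContinuousLinearMap.adjoint B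
       map_add' := fun B C => by simp
       map_smul' := fun c B => by simp } : (E →L[ℝ] E) →ₗ[ℝ] (E →L[ℝ] E))).contDiff

theorem contDiff_mul_inverse {k : WithTop ℕ∞} :
    ContDiff ℝ k (fun B : E →L[ℝ] E =>
      B * Ring.inverse (1 + B - ContinuousLinearMap.adjoint B)) := by
  rw [contDiff_iff_contDiffAt]
  intro B
  obtain ⟨a, ha⟩ := isUnit_one_add_sub_adjoint B
  have h : ContDiffAt ℝ k Ring.inverse (1 + B - ContinuousLinearMap.adjoint B) :=
    ha ▸ contDiffAt_ringInverse ℝ a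
  exact contDiffAt_id.mul (h.comp B
    ((contDiffAt_const.add contDiffAt_id).sub contDiff_adjoint.contDiffAt))

end Projection

/-! ### The field of tangential projections and its derivative -/

section ProjExtension

variable {n : ℕ} {M : Type*} [TopologicalSpace M] [ChartedSpace (EuclideanSpace ℝ (Fin n)) M]
  {E : Type*} [NormedAddCommGroup E] [InnerProductSpace ℝ E]

/-- `P` extends to the ambient space, near `x p`, the field of orthogonal projections onto the
tangent spaces. -/
structure IsProjExtension (x : Immersion n M E) (p : M) (P : E → E →L[ℝ] E) : Prop where
  differentiableAt : DifferentiableAt ℝ P (x.toFun p)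
  eventually_eq : ∀ᶠ q in 𝓝 p, P (x.toFun q) = (tangentSpace x q).starProjection

theorem fderiv_clm_apply_apply {F G : Type*} [NormedAddCommGroup F] [NormedSpace ℝ F]
    [NormedAddCommGroup G] [NormedSpace ℝ G] {P : E → F →L[ℝ] G} {V : E → F} {e : E}
    (hP : DifferentiableAt ℝ P e) (hV : DifferentiableAt ℝ V e) (u : E) :
    fderiv ℝ (fun e => P e (V e)) e u = fderiv ℝ P e u (V e) + P e (fderiv ℝ V e u) := by
  rw [fderiv_clm_apply hP hV]
  simp [add_comm]

theorem IsProjExtension.apply_self {x : Immersion n M E} {p : M} {P : E → E →L[ℝ] E}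
    (hP : IsProjExtension x p P) {u : E} (hu : u ∈ tangentSpace x p) : P (x.toFun p) u = u := by
  rw [hP.eventually_eq.self_of_nhds]
  exact Submodule.starProjection_eq_self_iff.mpr hu

theorem IsProjExtension.apply_mem {x : Immersion n M E} {p : M} {P : E → E →L[ℝ] E}
    (hP : IsProjExtension x p P) (v : E) : P (x.toFun p) v ∈ tangentSpace x p := by
  rw [hP.eventually_eq.self_of_nhds]
  exact Submodule.starProjection_apply_mem _ _

theorem IsProjExtension.inner_apply {x : Immersion n M E} {p : M} {P : E → E →L[ℝ] E}
    (hP : IsProjExtension x p P) (v w : E) :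
    inner ℝ (P (x.toFun p) v) w = inner ℝ v (P (x.toFun p) w) := by
  rw [hP.eventually_eq.self_of_nhds]
  exact Submodule.inner_starProjection_left_eq_right _ _ _

theorem IsProjExtension.eventually {x : Immersion n M E} {p : M} {P : E → E →L[ℝ] E}
    (hPs : ContDiffAt ℝ 1 P (x.toFun p)) (hP : IsProjExtension x p P) :
    ∀ᶠ q in 𝓝 p, IsProjExtension x q P := by
  filter_upwards [eventually_contDiffAt x (k := 1) hPs, hP.eventually_eq.eventually_nhds]
    with q h1 h2
  exact ⟨h1.differentiableAt (by simp), h2⟩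

/-- The derivative of the tangential projection maps tangent vectors to normal vectors. -/
theorem IsProjExtension.apply_fderiv {x : Immersion n M E} {p : M} {P : E → E →L[ℝ] E}
    (hP : IsProjExtension x p P) {u w : E} (hu : u ∈ tangentSpace x p)
    (hw : w ∈ tangentSpace x p) : P (x.toFun p) (fderiv ℝ P (x.toFun p) u w) = 0 := by
  have hd := hP.differentiableAt
  have h := fderiv_eq_of_eventually_eq x (g := fun e => P e (P e w)) (h := fun e => P e w) (p := p)
    (by
      filter_upwards [hP.eventually_eq] with q hq
      rw [hq]
      exact Submodule.starProjection_eq_self_iff.mpr (Submodule.starProjection_apply_mem _ _))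
    (hd.clm_apply (hd.clm_apply (differentiableAt_const _)))
    (hd.clm_apply (differentiableAt_const _)) hu
  rw [fderiv_clm_apply_apply hd (hd.clm_apply (differentiableAt_const _)),
    fderiv_clm_apply_apply hd (differentiableAt_const _), hP.apply_self hw] at h
  simpa using h

theorem IsProjExtension.inner_fderiv {x : Immersion n M E} {p : M} {P : E → E →L[ℝ] E}
    (hP : IsProjExtension x p P) {u : E} (hu : u ∈ tangentSpace x p) (v w : E) :
    inner ℝ (fderiv ℝ P (x.toFun p) u v) w = inner ℝ v (fderiv ℝ P (x.toFun p) u w) := by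
  have hd := hP.differentiableAt
  have hc : ∀ v : E, DifferentiableAt ℝ (fun e => P e v) (x.toFun p) := fun v =>
    hd.clm_apply (differentiableAt_const v)
  have h := fderiv_eq_of_eventually_eq x (g := fun e => inner ℝ (P e v) w)
    (h := fun e => inner ℝ v (P e w)) (p := p) (by
      filter_upwards [hP.eventually_eq] with q hq
      rw [hq]
      exact Submodule.inner_starProjection_left_eq_right _ _ _)
    ((hc v).inner ℝ (differentiableAt_const _)) ((differentiableAt_const _).inner ℝ (hc w)) hu
  rw [fderiv_inner_apply ℝ (hc v) (differentiableAt_const _),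
    fderiv_inner_apply ℝ (differentiableAt_const _) (hc w),
    fderiv_clm_apply_apply hd (differentiableAt_const _),
    fderiv_clm_apply_apply hd (differentiableAt_const _)] at h
  simpa using h

/-- This is the symmetry of the second fundamental form. The map `ρ = x ∘ s` is a local retraction
onto the submanifold, and at its points `dρ` is an oblique projection onto the tangent space, from
which `P` is built. Then `(D_u P) w` is the normal part of `D²ρ(u, w)`, and second derivatives are
symmetric. -/
theorem exists_projExtension_fderiv_symm [FiniteDimensional ℝ E] [IsManifold (𝓡 n) ∞ M]
    (x : Immersion n M E) (p : M) : ∃ P, ContDiffAt ℝ ∞ P (x.toFun p) ∧ IsProjExtension x p P ∧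
      ∀ u ∈ tangentSpace x p, ∀ w ∈ tangentSpace x p,
        fderiv ℝ P (x.toFun p) u w = fderiv ℝ P (x.toFun p) w u := by
  obtain ⟨s, hs, hsx⟩ := exists_local_leftInverse x p
  set ρ : E → E := x.toFun ∘ s with hρ
  have hρs : ContDiffAt ℝ ∞ ρ (x.toFun p) := by
    rw [← contMDiffAt_iff_contDiffAt]
    exact (x.smooth _).comp _ hs
  have hρs' : ContDiffAt ℝ ∞ (fderiv ℝ ρ) (x.toFun p) := hρs.fderiv_right (by simp)
  have hd : ∀ᶠ q in 𝓝 p, DifferentiableAt ℝ ρ (x.toFun q) :=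
    (eventually_contDiffAt x (k := 1) (hρs.of_le (by exact_mod_cast le_top))).mono
      fun q hq => hq.differentiableAt (by simp)
  have hρx : ∀ᶠ q in 𝓝 p, ρ (x.toFun q) = x.toFun q := hsx.mono fun q hq => by simp [hρ, hq]
  have hfix : ∀ᶠ q in 𝓝 p, ∀ u ∈ tangentSpace x q, fderiv ℝ ρ (x.toFun q) u = u := by
    filter_upwards [hρx.eventually_nhds, hd] with q hq hdq u hu
    rw [fderiv_eq_of_eventually_eq x (h := id) hq hdq differentiableAt_id hu]
    simp
  have hmem : ∀ᶠ q in 𝓝 p, ∀ v, fderiv ℝ ρ (x.toFun q) v ∈ tangentSpace x q := by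
    have hs1 : ∀ᶠ q in 𝓝 p, ContMDiffAt 𝓘(ℝ, E) (𝓡 n) 1 s (x.toFun q) :=
      haveI : IsManifold (𝓡 n) 1 M := IsManifold.of_le (n := ∞) (by exact_mod_cast le_top)
      (x.smooth.continuous.tendsto p).eventually
        ((contMDiffAt_iff_contMDiffAt_nhds (by simp)).mp (hs.of_le (by exact_mod_cast le_top)))
    filter_upwards [hs1, hsx] with q hq hsq v
    have h := mfderiv_comp_apply_of_eq (x.toFun q) (I := 𝓘(ℝ, E)) (I' := 𝓡 n) (I'' := 𝓘(ℝ, E))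
      ((x.smooth q).mdifferentiableAt (by simp)) (hq.mdifferentiableAt (by simp)) hsq v
    rw [mfderiv_eq_fderiv] at h
    rw [hρ]
    refine h ▸ ?_
    exact tangentSpace_differential x q _
  set P : E → E →L[ℝ] E := fun e => fderiv ℝ ρ e *
    Ring.inverse (1 + fderiv ℝ ρ e - ContinuousLinearMap.adjoint (fderiv ℝ ρ e)) with hPdef
  have hP : ContDiffAt ℝ ∞ P (x.toFun p) := contDiff_mul_inverse.contDiffAt.comp _ hρs'
  have hPx : ∀ᶠ q in 𝓝 p, P (x.toFun q) = (tangentSpace x q).starProjection := by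
    filter_upwards [hfix, hmem] with q hq hq'
    exact starProjection_eq_mul_inverse hq' hq
  have hPd : DifferentiableAt ℝ P (x.toFun p) := hP.differentiableAt (by simp)
  have hρd : DifferentiableAt ℝ (fderiv ℝ ρ) (x.toFun p) := hρs'.differentiableAt (by simp)
  have hPe : IsProjExtension x p P := ⟨hPd, hPx⟩
  refine ⟨P, hP, hPe, ?_⟩
  have key : ∀ u ∈ tangentSpace x p, ∀ w ∈ tangentSpace x p, fderiv ℝ P (x.toFun p) u w =
      fderiv ℝ (fderiv ℝ ρ) (x.toFun p) u w -
        (tangentSpace x p).starProjection (fderiv ℝ (fderiv ℝ ρ) (x.toFun p) u w) := by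
    intro u hu w hw
    have hPw : DifferentiableAt ℝ (fun e => P e w) (x.toFun p) :=
      hPd.clm_apply (differentiableAt_const _)
    -- Differentiating `dρ (P w) = P w` gives `D²ρ(u,w) + dρ((D_u P) w) = (D_u P) w`. Projecting to
    -- the tangent space kills the right side and fixes the `dρ` term, which identifies the latter
    -- as minus the tangential part of `D²ρ(u,w)`.
    have h := fderiv_eq_of_eventually_eq x (g := fun e => fderiv ℝ ρ e (P e w))
      (h := fun e => P e w) (p := p) (by
        filter_upwards [hfix, hPx] with q hq hq'
        rw [hq', hq _ (Submodule.starProjection_apply_mem _ _)])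
      (hρd.clm_apply hPw) hPw hu
    rw [fderiv_clm_apply_apply hρd hPw, fderiv_clm_apply_apply hPd (differentiableAt_const _),
      hPx.self_of_nhds, Submodule.starProjection_eq_self_iff.mpr hw] at h
    simp only [fderiv_fun_const, Pi.zero_apply, zero_apply, map_zero, add_zero] at h
    have h2 := congrArg (tangentSpace x p).starProjection h
    have h3 := hPe.apply_fderiv hu hw
    rw [hPx.self_of_nhds] at h3
    rw [map_add, h3,
      Submodule.starProjection_eq_self_iff.mpr (hmem.self_of_nhds _)] at h2
    rw [eq_neg_of_add_eq_zero_left h2, sub_neg_eq_add, h]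
  intro u hu w hw
  have hsymm : IsSymmSndFDerivAt ℝ ρ (x.toFun p) :=
    hρs.isSymmSndFDerivAt (by simpa using ENat.LEInfty.out)
  rw [key u hu w hw, key w hw u hu, hsymm.eq]

theorem exists_isProjExtension [FiniteDimensional ℝ E] [IsManifold (𝓡 n) ∞ M]
    (x : Immersion n M E) (p : M) :
    ∃ P, ContDiffAt ℝ ∞ P (x.toFun p) ∧ IsProjExtension x p P := by
  obtain ⟨P, hPs, hP, -⟩ := exists_projExtension_fderiv_symm x p
  exact ⟨P, hPs, hP⟩

/-- Tangential derivatives do not see the choice of extension, so the symmetry passes from the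
special extension to any other. -/
theorem IsProjExtension.fderiv_symm [FiniteDimensional ℝ E] [IsManifold (𝓡 n) ∞ M]
    {x : Immersion n M E} {p : M} {P : E → E →L[ℝ] E}
    (hP : IsProjExtension x p P) {u w : E} (hu : u ∈ tangentSpace x p)
    (hw : w ∈ tangentSpace x p) :
    fderiv ℝ P (x.toFun p) u w = fderiv ℝ P (x.toFun p) w u := by
  obtain ⟨Q, -, hQ, hQsymm⟩ := exists_projExtension_fderiv_symm x p
  have h : ∀ u ∈ tangentSpace x p, fderiv ℝ P (x.toFun p) u = fderiv ℝ Q (x.toFun p) u :=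
    fun u hu => fderiv_eq_of_eventually_eq x (by
      filter_upwards [hP.eventually_eq, hQ.eventually_eq] with q h1 h2
      rw [h1, h2]) hP.differentiableAt hQ.differentiableAt hu
  rw [h u hu, h w hw, hQsymm u hu w hw]

end ProjExtension

/-! ### Traces over a subspace -/

section Trace

variable {E : Type*} [NormedAddCommGroup E] [InnerProductSpace ℝ E]

/-- The trace as a continuous linear functional on endomorphisms. -/
noncomputable def traceCLM (E : Type*) [NormedAddCommGroup E] [InnerProductSpace ℝ E]
    [FiniteDimensional ℝ E] : (E →L[ℝ] E) →L[ℝ] ℝ :=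
  LinearMap.toContinuousLinearMap (LinearMap.trace ℝ E ∘ₗ ContinuousLinearMap.coeLM ℝ)

theorem traceCLM_mul_comm [FiniteDimensional ℝ E] (A B : E →L[ℝ] E) :
    traceCLM E (A * B) = traceCLM E (B * A) :=
  LinearMap.trace_mul_comm ℝ A.toLinearMap B.toLinearMap

theorem traceCLM_mul_starProjection [FiniteDimensional ℝ E] {ι : Type*} [Fintype ι]
    {U : Submodule ℝ E} (b : OrthonormalBasis ι ℝ U) (A : E →L[ℝ] E) :
    traceCLM E (A * U.starProjection) = ∑ i, inner ℝ (A (b i)) (b i : E) := by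
  rw [b.starProjection_eq_sum_rankOne, Finset.mul_sum, map_sum]
  refine Finset.sum_congr rfl fun i _ => ?_
  have h : A * InnerProductSpace.rankOne ℝ (b i : E) (b i : E) =
      InnerProductSpace.rankOne ℝ (A (b i)) (b i : E) := by
    ext v
    simp
  rw [h, real_inner_comm]
  exact InnerProductSpace.trace_rankOne _ _

end Trace

/-! ### Connections, second fundamental form and Laplacian through `P` and `G` -/

section Extrinsic

variable {n : ℕ} {M : Type*} [TopologicalSpace M] [ChartedSpace (EuclideanSpace ℝ (Fin n)) M]
  {E : Type*} [NormedAddCommGroup E] [InnerProductSpace ℝ E]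
  {x : Immersion n M E} {p : M} {P : E → E →L[ℝ] E}

theorem ambientDeriv_eq_fderiv {V : M → E} {g : E → E}
    (hV : ∀ᶠ q in 𝓝 p, V q = g (x.toFun q)) (hg : DifferentiableAt ℝ g (x.toFun p))
    (u : tangentSpace x p) : ambientDeriv x V p u = fderiv ℝ g (x.toFun p) u :=
  dmap_toIntrinsic x hV hg u

theorem IsProjExtension.coe_tangential (hP : IsProjExtension x p P) (v : E) :
    (tangential x p v : E) = P (x.toFun p) v := by
  rw [hP.eventually_eq.self_of_nhds]
  rfl

theorem IsProjExtension.normalPart_eq (hP : IsProjExtension x p P) (v : E) :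
    normalPart x p v = v - P (x.toFun p) v := by
  rw [normalPart, hP.coe_tangential]

theorem IsProjExtension.eventually_coe_extend (hP : IsProjExtension x p P)
    (w : tangentSpace x p) :
    ∀ᶠ q in 𝓝 p, (extend x w q : E) = P (x.toFun q) w := by
  filter_upwards [hP.eventually_eq] with q hq
  rw [hq]
  rfl

theorem IsProjExtension.ambientDeriv_extend (hP : IsProjExtension x p P)
    (u w : tangentSpace x p) :
    ambientDeriv x (fun q => (extend x w q : E)) p u = fderiv ℝ P (x.toFun p) u w := by
  rw [ambientDeriv_eq_fderiv (hP.eventually_coe_extend w)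
      (hP.differentiableAt.clm_apply (differentiableAt_const _)),
    fderiv_clm_apply_apply hP.differentiableAt (differentiableAt_const _)]
  simp

theorem IsProjExtension.secondFF_eq (hP : IsProjExtension x p P) (u w : tangentSpace x p) :
    secondFF x p u w = fderiv ℝ P (x.toFun p) u w := by
  rw [secondFF, hP.normalPart_eq, hP.ambientDeriv_extend, hP.apply_fderiv u.2 w.2, sub_zero]

/-- The projected constant field is parallel at `p`, so the correction term of the normal Hessian
vanishes there. -/
theorem IsProjExtension.tangentConn_extend (hP : IsProjExtension x p P)
    (u w : tangentSpace x p) : tangentConn x (fun q => (extend x w q : E)) p u = 0 := by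
  ext
  rw [tangentConn, hP.coe_tangential, hP.ambientDeriv_extend, hP.apply_fderiv u.2 w.2]
  rfl

theorem IsProjExtension.normalConn_eq (hP : IsProjExtension x p P) {V : M → E} {g : E → E}
    (hV : ∀ᶠ q in 𝓝 p, V q = g (x.toFun q)) (hg : DifferentiableAt ℝ g (x.toFun p))
    (u : tangentSpace x p) :
    normalConn x V p u =
      fderiv ℝ g (x.toFun p) u - P (x.toFun p) (fderiv ℝ g (x.toFun p) u) := by
  rw [normalConn, hP.normalPart_eq, ambientDeriv_eq_fderiv hV hg]

/-- `toIntrinsic` is a choice of preimage; injectivity of the differential forces it to be zero at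
zero. -/
theorem normalConn_zero (x : Immersion n M E) (V : M → E) (p : M) : normalConn x V p 0 = 0 := by
  have h : toIntrinsic x p 0 = 0 := by
    apply x.injective_mfderiv p
    rw [map_zero]
    exact differential_toIntrinsic x p 0
  have h2 : ambientDeriv x V p 0 = 0 := by
    rw [ambientDeriv, h]
    exact map_zero (dmap V p)
  simp [normalConn, normalPart, tangential, h2]

/-- The normal Hessian of a vector field `V` whose normal derivative in the direction of the
tangential extension of `w` is extended by `h`. -/
theorem IsProjExtension.normalHessian_eq (hP : IsProjExtension x p P) {V : M → E}
    {h : E → E} {u w : tangentSpace x p}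
    (hV : ∀ᶠ q in 𝓝 p, normalConn x V q (extend x w q) = h (x.toFun q))
    (hh : DifferentiableAt ℝ h (x.toFun p)) :
    normalHessian x V p u w =
      fderiv ℝ h (x.toFun p) u - P (x.toFun p) (fderiv ℝ h (x.toFun p) u) := by
  rw [normalHessian, hP.tangentConn_extend, normalConn_zero, sub_zero,
    hP.normalConn_eq hV hh]

theorem inner_grad {f : M → ℝ} {F : E → ℝ} (hf : ∀ᶠ q in 𝓝 p, f q = F (x.toFun q))
    (hF : DifferentiableAt ℝ F (x.toFun p)) {u : E} (hu : u ∈ tangentSpace x p) :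
    inner ℝ (grad x f p : E) u = fderiv ℝ F (x.toFun p) u := by
  have h := (frame x p).sum_repr' ⟨u, hu⟩
  have h2 : ∑ i, inner ℝ (frame x p i : E) u • (frame x p i : E) = u := by
    simpa using congrArg (Subtype.val) h
  conv_rhs => rw [← h2, map_sum]
  rw [grad, AddSubmonoidClass.coe_finsetSum, sum_inner]
  refine Finset.sum_congr rfl fun i _ => ?_
  rw [dmap_toIntrinsic x hf hF, Submodule.coe_smul, real_inner_smul_left, map_smul, smul_eq_mul,
    mul_comm]

theorem inner_grad_differential {f : M → ℝ} {F : E → ℝ} (hf : ∀ᶠ q in 𝓝 p, f q = F (x.toFun q))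
    (hF : DifferentiableAt ℝ F (x.toFun p)) (v : TangentSpace (𝓡 n) p) :
    inner ℝ (grad x f p : E) (differential x p v) = dmap f p v := by
  rw [inner_grad hf hF (tangentSpace_differential x p v), dmap_eq_fderiv_differential x hf hF]

theorem IsProjExtension.grad_eq [FiniteDimensional ℝ E] (hP : IsProjExtension x p P) {f : M → ℝ}
    {F : E → ℝ} (hf : ∀ᶠ q in 𝓝 p, f q = F (x.toFun q))
    (hF : DifferentiableAt ℝ F (x.toFun p)) :
    (grad x f p : E) = P (x.toFun p) (gradient F (x.toFun p)) := by
  refine ext_inner_right ℝ fun w => ?_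
  rw [hP.inner_apply, inner_gradient_left, ← inner_grad hf hF (hP.apply_mem w), ← hP.inner_apply,
    hP.apply_self (grad x f p).2]

/-- The covariant derivative of a tangent vector field `G`. -/
noncomputable def covDeriv (P : E → E →L[ℝ] E) (G : E → E) (e : E) : E →L[ℝ] E :=
  P e * fderiv ℝ G e * P e

theorem IsProjExtension.laplacian_eq [FiniteDimensional ℝ E] (hP : IsProjExtension x p P)
    {f : M → ℝ} {G : E → E} (hG : ∀ᶠ q in 𝓝 p, (grad x f q : E) = G (x.toFun q))
    (hGd : DifferentiableAt ℝ G (x.toFun p)) :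
    laplacian x f p = traceCLM E (covDeriv P G (x.toFun p)) := by
  have h : covDeriv P G (x.toFun p) =
      (P (x.toFun p) * fderiv ℝ G (x.toFun p)) * (tangentSpace x p).starProjection := by
    rw [covDeriv, hP.eventually_eq.self_of_nhds]
  rw [h, traceCLM_mul_starProjection (frame x p), laplacian]
  refine Finset.sum_congr rfl fun i _ => ?_
  rw [tangentConn, ambientDeriv_eq_fderiv hG hGd, Submodule.coe_inner, hP.coe_tangential]
  rfl

end Extrinsic

/-! ### Hessian symmetry, Gauss equation and Bochner formula -/

section Bochner

variable {n : ℕ} {M : Type*} [TopologicalSpace M] [ChartedSpace (EuclideanSpace ℝ (Fin n)) M]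
  {E : Type*} [NormedAddCommGroup E] [InnerProductSpace ℝ E]
  {x : Immersion n M E} {p : M} {P : E → E →L[ℝ] E} {F : E → ℝ} {G : E → E}

/-- Near `x p`, the vector field `G` extends the gradient of the restriction of `F` to the
submanifold. -/
structure IsGradExtension (x : Immersion n M E) (p : M) (F : E → ℝ) (G : E → E) : Prop where
  contDiffAt_potential : ContDiffAt ℝ 2 F (x.toFun p)
  contDiffAt : ContDiffAt ℝ 2 G (x.toFun p)
  eventually_mem : ∀ᶠ q in 𝓝 p, G (x.toFun q) ∈ tangentSpace x q
  eventually_inner : ∀ᶠ q in 𝓝 p, ∀ w ∈ tangentSpace x q,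
    inner ℝ (G (x.toFun q)) w = fderiv ℝ F (x.toFun q) w

namespace IsGradExtension

theorem eventually (hG : IsGradExtension x p F G) : ∀ᶠ q in 𝓝 p, IsGradExtension x q F G := by
  filter_upwards [eventually_contDiffAt x (k := 2) hG.contDiffAt_potential,
    eventually_contDiffAt x (k := 2) hG.contDiffAt, hG.eventually_mem.eventually_nhds,
    hG.eventually_inner.eventually_nhds] with q h1 h2 h3 h4
  exact ⟨h1, h2, h3, h4⟩

theorem differentiableAt (hG : IsGradExtension x p F G) : DifferentiableAt ℝ G (x.toFun p) :=
  hG.contDiffAt.differentiableAt (by simp)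

theorem differentiableAt_fderiv (hG : IsGradExtension x p F G) :
    DifferentiableAt ℝ (fderiv ℝ G) (x.toFun p) :=
  (hG.contDiffAt.fderiv_right (m := 1) (by norm_num)).differentiableAt (by simp)

/-- The Hessian of a function is symmetric. -/
theorem inner_fderiv_symm [FiniteDimensional ℝ E] [IsManifold (𝓡 n) ∞ M]
    (hG : IsGradExtension x p F G) {u v : E}
    (hu : u ∈ tangentSpace x p) (hv : v ∈ tangentSpace x p) :
    inner ℝ (fderiv ℝ G (x.toFun p) u) v = inner ℝ (fderiv ℝ G (x.toFun p) v) u := by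
  obtain ⟨P, -, hP⟩ := exists_isProjExtension x p
  have hPd := hP.differentiableAt
  have hFd : DifferentiableAt ℝ (fderiv ℝ F) (x.toFun p) :=
    (hG.contDiffAt_potential.fderiv_right (m := 1) (by norm_num)).differentiableAt (by simp)
  -- Differentiate `⟨G, P v⟩ = dF(P v)` along `u`. The term `⟨G, (D_u P) v⟩` drops out, being
  -- tangent against normal, and both terms on the right are symmetric in `u` and `v`.
  have key : ∀ u ∈ tangentSpace x p, ∀ v ∈ tangentSpace x p,
      inner ℝ (fderiv ℝ G (x.toFun p) u) v =
        fderiv ℝ (fderiv ℝ F) (x.toFun p) u v +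
          fderiv ℝ F (x.toFun p) (fderiv ℝ P (x.toFun p) u v) := by
    intro u hu v hv
    have hPv : DifferentiableAt ℝ (fun e => P e v) (x.toFun p) :=
      hPd.clm_apply (differentiableAt_const _)
    have h := fderiv_eq_of_eventually_eq x (g := fun e => inner ℝ (G e) (P e v))
      (h := fun e => fderiv ℝ F e (P e v)) (p := p) (by
        filter_upwards [hP.eventually_eq, hG.eventually_inner] with q h1 h2
        rw [h1]
        exact h2 _ (Submodule.starProjection_apply_mem _ _))
      (hG.differentiableAt.inner ℝ hPv) (hFd.clm_apply hPv) hu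
    rw [fderiv_inner_apply ℝ hG.differentiableAt hPv, fderiv_clm_apply_apply hFd hPv,
      fderiv_clm_apply_apply hPd (differentiableAt_const _), hP.apply_self hv] at h
    have h0 : inner ℝ (G (x.toFun p)) (fderiv ℝ P (x.toFun p) u v) = 0 := by
      rw [← hP.apply_self hG.eventually_mem.self_of_nhds, hP.inner_apply, hP.apply_fderiv hu hv,
        inner_zero_right]
    simpa [h0] using h
  have hsymm : IsSymmSndFDerivAt ℝ F (x.toFun p) :=
    hG.contDiffAt_potential.isSymmSndFDerivAt (by simp)
  rw [key u hu v hv, key v hv u hu, hsymm.eq, hP.fderiv_symm hu hv]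

theorem inner_covDeriv_symm [FiniteDimensional ℝ E] [IsManifold (𝓡 n) ∞ M]
    (hG : IsGradExtension x p F G) (hP : IsProjExtension x p P) (v w : E) :
    inner ℝ (covDeriv P G (x.toFun p) v) w = inner ℝ v (covDeriv P G (x.toFun p) w) := by
  simp only [covDeriv, mul_apply_eq_comp]
  rw [hP.inner_apply, ← hP.inner_apply v, real_inner_comm _ (P (x.toFun p) v),
    hG.inner_fderiv_symm (hP.apply_mem v) (hP.apply_mem w)]

theorem differentiableAt_covDeriv (hG : IsGradExtension x p F G) (hP : IsProjExtension x p P) :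
    DifferentiableAt ℝ (covDeriv P G) (x.toFun p) :=
  (hP.differentiableAt.mul hG.differentiableAt_fderiv).mul hP.differentiableAt

theorem inner_fderiv_covDeriv_symm [FiniteDimensional ℝ E] [IsManifold (𝓡 n) ∞ M]
    (hG : IsGradExtension x p F G) (hP : IsProjExtension x p P)
    (hPs : ContDiffAt ℝ 1 P (x.toFun p)) {u : E} (hu : u ∈ tangentSpace x p) (v w : E) :
    inner ℝ (fderiv ℝ (covDeriv P G) (x.toFun p) u v) w =
      inner ℝ v (fderiv ℝ (covDeriv P G) (x.toFun p) u w) := by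
  have hK := hG.differentiableAt_covDeriv hP
  have hc : ∀ v : E, DifferentiableAt ℝ (fun e => covDeriv P G e v) (x.toFun p) := fun v =>
    hK.clm_apply (differentiableAt_const v)
  have h := fderiv_eq_of_eventually_eq x (g := fun e => inner ℝ (covDeriv P G e v) w)
    (h := fun e => inner ℝ v (covDeriv P G e w)) (p := p) (by
      filter_upwards [hG.eventually, hP.eventually hPs] with q h1 h2
      exact h1.inner_covDeriv_symm h2 v w)
    ((hc v).inner ℝ (differentiableAt_const _)) ((differentiableAt_const _).inner ℝ (hc w)) hu
  rw [fderiv_inner_apply ℝ (hc v) (differentiableAt_const _),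
    fderiv_inner_apply ℝ (differentiableAt_const _) (hc w),
    fderiv_clm_apply_apply hK (differentiableAt_const _),
    fderiv_clm_apply_apply hK (differentiableAt_const _)] at h
  simpa using h

/-- The normal part of the derivative of a tangent field is given by the second fundamental
form. -/
theorem fderiv_eq_add (hG : IsGradExtension x p F G) (hP : IsProjExtension x p P)
    {u : E} (hu : u ∈ tangentSpace x p) :
    fderiv ℝ G (x.toFun p) u =
      fderiv ℝ P (x.toFun p) u (G (x.toFun p)) + P (x.toFun p) (fderiv ℝ G (x.toFun p) u) := by
  have h := fderiv_eq_of_eventually_eq x (g := fun e => P e (G e)) (h := G) (p := p) (by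
      filter_upwards [hP.eventually_eq, hG.eventually_mem] with q h1 h2
      rw [h1]
      exact Submodule.starProjection_eq_self_iff.mpr h2)
    (hP.differentiableAt.clm_apply hG.differentiableAt) hG.differentiableAt hu
  rw [fderiv_clm_apply_apply hP.differentiableAt hG.differentiableAt] at h
  exact h.symm

/-- The commutation of second covariant derivatives of a tangent field, with the curvature given by
the Gauss equation. -/
theorem inner_fderiv_covDeriv_sub [FiniteDimensional ℝ E] [IsManifold (𝓡 n) ∞ M]
    (hG : IsGradExtension x p F G) (hP : IsProjExtension x p P) {u v w : E}
    (hu : u ∈ tangentSpace x p) (hv : v ∈ tangentSpace x p) (hw : w ∈ tangentSpace x p) :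
    inner ℝ (fderiv ℝ (covDeriv P G) (x.toFun p) u w) v
      - inner ℝ (fderiv ℝ (covDeriv P G) (x.toFun p) w u) v =
    inner ℝ (fderiv ℝ P (x.toFun p) w (G (x.toFun p))) (fderiv ℝ P (x.toFun p) u v)
      - inner ℝ (fderiv ℝ P (x.toFun p) u (G (x.toFun p))) (fderiv ℝ P (x.toFun p) w v) := by
  have hPd := hP.differentiableAt
  -- In `D_u (P DG P) w` paired with `v`, the factor `D_u P` moves onto `v` and gives a normal
  -- vector, so only the normal part `A(w, G)` of `D_w G` survives. The other terms are symmetric in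
  -- `u` and `w` and cancel in the difference.
  have key : ∀ u ∈ tangentSpace x p, ∀ w ∈ tangentSpace x p,
      inner ℝ (fderiv ℝ (covDeriv P G) (x.toFun p) u w) v =
        inner ℝ (fderiv ℝ P (x.toFun p) w (G (x.toFun p))) (fderiv ℝ P (x.toFun p) u v)
          + inner ℝ (fderiv ℝ (fderiv ℝ G) (x.toFun p) u w
            + fderiv ℝ G (x.toFun p) (fderiv ℝ P (x.toFun p) u w)) v := by
    intro u hu w hw
    have hPw : DifferentiableAt ℝ (fun e => P e w) (x.toFun p) :=
      hPd.clm_apply (differentiableAt_const _)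
    have hGw : DifferentiableAt ℝ (fun e => fderiv ℝ G e (P e w)) (x.toFun p) :=
      hG.differentiableAt_fderiv.clm_apply hPw
    have h : fderiv ℝ (covDeriv P G) (x.toFun p) u w =
        fderiv ℝ (fun e => P e (fderiv ℝ G e (P e w))) (x.toFun p) u := by
      have := fderiv_clm_apply_apply (hG.differentiableAt_covDeriv hP)
        (differentiableAt_const w) u
      simp only [fderiv_fun_const, Pi.zero_apply, zero_apply, map_zero, add_zero] at this
      rw [← this]
      rfl
    rw [h, fderiv_clm_apply_apply hPd hGw, fderiv_clm_apply_apply hG.differentiableAt_fderiv hPw,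
      fderiv_clm_apply_apply hPd (differentiableAt_const _), hP.apply_self hw, inner_add_left,
      hP.inner_fderiv hu, hP.inner_apply, hP.apply_self hv]
    nth_rewrite 1 [hG.fderiv_eq_add hP hw]
    rw [inner_add_left, hP.inner_apply _ (fderiv ℝ P (x.toFun p) u v), hP.apply_fderiv hu hv]
    simp
  have hsymm : IsSymmSndFDerivAt ℝ G (x.toFun p) :=
    hG.contDiffAt.isSymmSndFDerivAt (by simp)
  rw [key u hu w hw, key w hw u hu, hsymm.eq, hP.fderiv_symm hu hw]
  ring

/-- Differentiating `K = K P` gives `D_w K = (D_w K) P + K (D_w P)`. The last product has trace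
zero: by cyclicity it contains `P (D_w P) P = 0`. -/
theorem traceCLM_fderiv_covDeriv [FiniteDimensional ℝ E] {ι : Type*} [Fintype ι]
    (b : OrthonormalBasis ι ℝ (tangentSpace x p)) (hG : IsGradExtension x p F G)
    (hP : IsProjExtension x p P) {w : E} (hw : w ∈ tangentSpace x p) :
    traceCLM E (fderiv ℝ (covDeriv P G) (x.toFun p) w) =
      ∑ i, inner ℝ (fderiv ℝ (covDeriv P G) (x.toFun p) w (b i)) (b i : E) := by
  have hK := hG.differentiableAt_covDeriv hP
  have hidem : ∀ᶠ q in 𝓝 p, P (x.toFun q) * P (x.toFun q) = P (x.toFun q) := by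
    filter_upwards [hP.eventually_eq] with q hq
    rw [hq]
    exact Submodule.isIdempotentElem_starProjection _
  have h := fderiv_eq_of_eventually_eq x (g := covDeriv P G) (h := fun e => covDeriv P G e * P e)
    (p := p) (by
      filter_upwards [hidem] with q hq
      simp only [covDeriv, mul_assoc, hq]) hK (hK.mul hP.differentiableAt) hw
  rw [fderiv_fun_mul' hK hP.differentiableAt] at h
  have h1 : P (x.toFun p) * fderiv ℝ P (x.toFun p) w * P (x.toFun p) = 0 := by
    ext v
    exact hP.apply_fderiv hw (hP.apply_mem v)
  have h2 : traceCLM E (covDeriv P G (x.toFun p) * fderiv ℝ P (x.toFun p) w) = 0 := by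
    rw [covDeriv, mul_assoc, mul_assoc, traceCLM_mul_comm, mul_assoc, mul_assoc,
      ← mul_assoc (P _), h1, mul_zero, map_zero]
  rw [← traceCLM_mul_starProjection b, ← hP.eventually_eq.self_of_nhds]
  exact (congrArg (traceCLM E) h).trans (by simp [h2])

/-- The Bochner formula `Δ∇f = ∇Δf + Ric(∇f)`, with the Ricci curvature given by the Gauss
equation. -/
theorem bochner [FiniteDimensional ℝ E] [IsManifold (𝓡 n) ∞ M] {ι : Type*} [Fintype ι]
    (b : OrthonormalBasis ι ℝ (tangentSpace x p)) (hG : IsGradExtension x p F G)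
    (hP : IsProjExtension x p P) (hPs : ContDiffAt ℝ 1 P (x.toFun p)) {w : E}
    (hw : w ∈ tangentSpace x p) :
    ∑ i, inner ℝ (fderiv ℝ (covDeriv P G) (x.toFun p) (b i) (b i)) w =
      traceCLM E (fderiv ℝ (covDeriv P G) (x.toFun p) w)
      + inner ℝ (fderiv ℝ P (x.toFun p) w (G (x.toFun p)))
          (∑ i, fderiv ℝ P (x.toFun p) (b i) (b i))
      - ∑ i, inner ℝ (fderiv ℝ P (x.toFun p) (b i) (G (x.toFun p)))
          (fderiv ℝ P (x.toFun p) (b i) w) := by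
  rw [hG.traceCLM_fderiv_covDeriv b hP hw, inner_sum, ← Finset.sum_add_distrib,
    ← Finset.sum_sub_distrib]
  refine Finset.sum_congr rfl fun i _ => ?_
  -- Self-adjointness of `D_{b_i} K` moves `w` into its argument; commuting derivatives then turns
  -- `⟨(D_{b_i} K) w, b_i⟩` into the trace term `⟨(D_w K) b_i, b_i⟩`.
  have h := hG.inner_fderiv_covDeriv_sub hP (b i).2 (b i).2 hw
  rw [hG.inner_fderiv_covDeriv_symm hP hPs (b i).2, real_inner_comm,
    hP.fderiv_symm (b i).2 hw]
  linarith

end IsGradExtension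

end Bochner

/-! ### Regularity of the gradient and of the drift Laplacian -/

section Gradient

variable {n : ℕ} {M : Type*} [TopologicalSpace M] [ChartedSpace (EuclideanSpace ℝ (Fin n)) M]
  {E : Type*} [NormedAddCommGroup E] [InnerProductSpace ℝ E] [FiniteDimensional ℝ E]
  {x : Immersion n M E} {p : M} {P : E → E →L[ℝ] E} {f : M → ℝ} {F : E → ℝ} {G : E → E}

theorem contDiffAt_gradient {k m : WithTop ℕ∞} {e : E} (hF : ContDiffAt ℝ m F e)
    (hkm : k + 1 ≤ m) : ContDiffAt ℝ k (gradient F) e := by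
  have h : ContDiff ℝ k (fun l : E →L[ℝ] ℝ => (InnerProductSpace.toDual ℝ E).symm l) :=
    (LinearMap.toContinuousLinearMap
      ({ toFun := fun l => (InnerProductSpace.toDual ℝ E).symm l
         map_add' := fun _ _ => by simp
         map_smul' := fun _ _ => by simp } : (E →L[ℝ] ℝ) →ₗ[ℝ] E)).contDiff
  exact h.contDiffAt.comp e (hF.fderiv_right hkm)

theorem exists_grad_extension [IsManifold (𝓡 n) ∞ M] (x : Immersion n M E) {k m : ℕ∞}
    (hkm : (k + 1 : WithTop ℕ∞) ≤ m) {p : M} (hf : ContMDiffAt (𝓡 n) 𝓘(ℝ, ℝ) m f p) :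
    ∃ F : E → ℝ, ∃ G : E → E, ContDiffAt ℝ m F (x.toFun p) ∧ ContDiffAt ℝ k G (x.toFun p) ∧
      (∀ᶠ q in 𝓝 p, ∀ w ∈ tangentSpace x q,
        inner ℝ (grad x f q : E) w = fderiv ℝ F (x.toFun q) w) ∧
      ∀ᶠ q in 𝓝 p, (grad x f q : E) = G (x.toFun q) := by
  obtain ⟨F, hF, hfF⟩ := exists_local_extension x hf
  obtain ⟨P, hPs, hP⟩ := exists_isProjExtension x p
  have hFd : ∀ᶠ q in 𝓝 p, DifferentiableAt ℝ F (x.toFun q) :=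
    (eventually_contDiffAt x (k := 1) (hF.of_le (le_trans (by simp) hkm))).mono
      fun q hq => hq.differentiableAt (by simp)
  refine ⟨F, fun e => P e (gradient F e), hF,
    (hPs.of_le (by exact_mod_cast le_top)).clm_apply (contDiffAt_gradient hF hkm), ?_, ?_⟩
  · filter_upwards [hFd, hfF.eventually_nhds] with q h1 h2 w hw
    exact inner_grad h2 h1 hw
  · filter_upwards [hFd, hfF.eventually_nhds, hP.eventually (hPs.of_le (by simp))] with q h1 h2 h3
    exact h3.grad_eq h2 h1

theorem exists_isGradExtension [IsManifold (𝓡 n) ∞ M] (x : Immersion n M E) {k m : ℕ∞}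
    (hkm : (k + 1 : WithTop ℕ∞) ≤ m) (hk : (2 : WithTop ℕ∞) ≤ k) {p : M}
    (hf : ContMDiffAt (𝓡 n) 𝓘(ℝ, ℝ) m f p) :
    ∃ F : E → ℝ, ∃ G : E → E, IsGradExtension x p F G ∧ ContDiffAt ℝ k G (x.toFun p) ∧
      ∀ᶠ q in 𝓝 p, (grad x f q : E) = G (x.toFun q) := by
  obtain ⟨F, G, hF, hG, h1, h2⟩ := exists_grad_extension x hkm hf
  refine ⟨F, G, ⟨hF.of_le (hk.trans (le_trans (by simp) hkm)), hG.of_le hk, ?_, ?_⟩, hG, h2⟩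
  · filter_upwards [h2] with q hq
    rw [← hq]
    exact (grad x f q).2
  · filter_upwards [h1, h2] with q hq hq' w hw
    rw [← hq', hq w hw]

/-- An extension of the drift Laplacian to the ambient space. -/
noncomputable def driftExtension (P : E → E →L[ℝ] E) (T : E) (G : E → E) (e : E) : ℝ :=
  traceCLM E (covDeriv P G e) + inner ℝ T (G e)

theorem IsGradExtension.eventually_driftLaplacian (hG : IsGradExtension x p F G)
    (hP : IsProjExtension x p P) (hPs : ContDiffAt ℝ 1 P (x.toFun p))
    (hfG : ∀ᶠ q in 𝓝 p, (grad x f q : E) = G (x.toFun q)) (T : E) :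
    ∀ᶠ q in 𝓝 p, driftLaplacian x T f q = driftExtension P T G (x.toFun q) := by
  filter_upwards [hG.eventually, hP.eventually hPs, hfG.eventually_nhds] with q h1 h2 h3
  rw [driftLaplacian, h2.laplacian_eq h3 h1.differentiableAt, h3.self_of_nhds, driftExtension]

theorem contDiffAt_driftExtension {k m : WithTop ℕ∞} {e T : E} (hG : ContDiffAt ℝ m G e)
    (hP : ContDiffAt ℝ k P e) (hkm : k + 1 ≤ m) : ContDiffAt ℝ k (driftExtension P T G) e := by
  refine ContDiffAt.add ((traceCLM E).contDiff.contDiffAt.comp e ?_)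
    (contDiffAt_const.inner ℝ (hG.of_le (le_trans (by simp) hkm)))
  exact (hP.mul (hG.fderiv_right hkm)).mul hP

theorem fderiv_driftExtension (hG : IsGradExtension x p F G) (hP : IsProjExtension x p P)
    (T w : E) :
    fderiv ℝ (driftExtension P T G) (x.toFun p) w =
      traceCLM E (fderiv ℝ (covDeriv P G) (x.toFun p) w)
        + inner ℝ T (fderiv ℝ G (x.toFun p) w) := by
  have h1 := (traceCLM E).hasFDerivAt.comp (x.toFun p)
    (hG.differentiableAt_covDeriv hP).hasFDerivAt
  have h2 := (differentiableAt_const T).inner ℝ hG.differentiableAt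
  have h3 := fderiv_add h1.differentiableAt h2
  have h4 : fderiv ℝ (driftExtension P T G) (x.toFun p) = _ := h3
  rw [h4, add_apply, h1.fderiv, fderiv_inner_apply ℝ (differentiableAt_const T) hG.differentiableAt]
  simp

theorem contMDiff_driftLaplacian [IsManifold (𝓡 n) ∞ M] (x : Immersion n M E) (T : E)
    (hf : ContMDiff (𝓡 n) 𝓘(ℝ, ℝ) ∞ f) :
    ContMDiff (𝓡 n) 𝓘(ℝ, ℝ) ∞ (driftLaplacian x T f) := by
  intro p
  obtain ⟨F, G, hG, hGs, hfG⟩ := exists_isGradExtension x (k := ⊤) (m := ⊤) (by simp) ENat.LEInfty.out (hf p)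
  obtain ⟨P, hPs, hP⟩ := exists_isProjExtension x p
  have h := hG.eventually_driftLaplacian hP (hPs.of_le (by simp)) hfG T
  exact ((contDiffAt_driftExtension hGs hPs (by simp)).contMDiffAt.comp p
    (x.smooth p)).congr_of_eventuallyEq h

theorem contMDiff_grad [IsManifold (𝓡 n) ∞ M] (x : Immersion n M E)
    (hf : ContMDiff (𝓡 n) 𝓘(ℝ, ℝ) ∞ f) :
    ContMDiff (𝓡 n) 𝓘(ℝ, E) ∞ (fun p => (grad x f p : E)) := by
  intro p
  obtain ⟨F, G, -, hGs, hfG⟩ := exists_isGradExtension x (k := ⊤) (m := ⊤) (by simp) ENat.LEInfty.out (hf p)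
  exact (hGs.contMDiffAt.comp p (x.smooth p)).congr_of_eventuallyEq hfG

end Gradient

/-! ### The complex structure on a Lagrangian submanifold -/

section Lagrangian

variable {n : ℕ} {M : Type*} [TopologicalSpace M] [ChartedSpace (EuclideanSpace ℝ (Fin n)) M]
  {x : Immersion n M (EuclideanSpace ℂ (Fin n))} {p : M}
  {P : EuclideanSpace ℂ (Fin n) → EuclideanSpace ℂ (Fin n) →L[ℝ] EuclideanSpace ℂ (Fin n)}
  {f : M → ℝ} {F : EuclideanSpace ℂ (Fin n) → ℝ}
  {G : EuclideanSpace ℂ (Fin n) → EuclideanSpace ℂ (Fin n)}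

/-- The complex structure of `ℂⁿ` as a real linear map. -/
noncomputable def complexStructure (n : ℕ) :
    EuclideanSpace ℂ (Fin n) →L[ℝ] EuclideanSpace ℂ (Fin n) :=
  LinearMap.toContinuousLinearMap (LinearMap.lsmul ℂ (EuclideanSpace ℂ (Fin n)) Complex.I
    |>.restrictScalars ℝ)

local notation "J" => complexStructure _

theorem complexStructure_apply (v : EuclideanSpace ℂ (Fin n)) : J v = Complex.I • v :=
  rfl

theorem complexStructure_complexStructure (v : EuclideanSpace ℂ (Fin n)) : J (J v) = -v := by
  simp [complexStructure_apply, smul_smul]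

theorem inner_complexStructure (v w : EuclideanSpace ℂ (Fin n)) :
    inner ℝ (J v) (J w) = inner ℝ v w := by
  simp only [complexStructure_apply, PiLp.inner_apply, Complex.inner, PiLp.smul_apply, smul_eq_mul,
    map_mul, Complex.conj_I]
  refine Finset.sum_congr rfl fun i _ => ?_
  congr 1
  linear_combination (-(starRingEnd ℂ) (v i) * w i) * Complex.I_mul_I

theorem inner_complexStructure_left (v w : EuclideanSpace ℂ (Fin n)) :
    inner ℝ (J v) w = -inner ℝ v (J w) := by
  rw [← inner_complexStructure v, complexStructure_complexStructure, inner_neg_right, neg_neg]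

theorem finrank_tangentSpace {E : Type*} [NormedAddCommGroup E] [InnerProductSpace ℝ E]
    (x : Immersion n M E) (p : M) : Module.finrank ℝ (tangentSpace x p) = n := by
  have h : Function.Injective (differential x p).toLinearMap := x.injective_mfderiv p
  rw [tangentSpace, LinearMap.finrank_range_of_inj h]
  exact finrank_euclideanSpace_fin

theorem IsLagrangian.complexStructure_mem_orthogonal (hx : IsLagrangian x)
    {u : EuclideanSpace ℂ (Fin n)} (hu : u ∈ tangentSpace x p) : J u ∈ (tangentSpace x p)ᗮ := by
  rw [Submodule.mem_orthogonal']
  obtain ⟨v, rfl⟩ := hu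
  rintro _ ⟨w, rfl⟩
  exact hx p v w

/-- `J` embeds the tangent space in the normal space. Both have dimension `n`, so every normal
vector is `J w` with `w` tangent, and `J (J w) = -w`. -/
theorem IsLagrangian.complexStructure_mem (hx : IsLagrangian x)
    {u : EuclideanSpace ℂ (Fin n)} (hu : u ∈ (tangentSpace x p)ᗮ) : J u ∈ tangentSpace x p := by
  have hinj : Function.Injective (complexStructure n).toLinearMap := fun v w h => by
    have h' := congrArg (J : EuclideanSpace ℂ (Fin n) → _) (show J v = J w from h)
    simpa [complexStructure_complexStructure] using h'
  have hle : (tangentSpace x p).map (complexStructure n).toLinearMap ≤ (tangentSpace x p)ᗮ := by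
    rintro _ ⟨w, hw, rfl⟩
    exact hx.complexStructure_mem_orthogonal hw
  have heq : (tangentSpace x p).map (complexStructure n).toLinearMap = (tangentSpace x p)ᗮ := by
    refine Submodule.eq_of_le_of_finrank_eq hle ?_
    have h1 := (tangentSpace x p).finrank_add_finrank_orthogonal
    have h2 : Module.finrank ℝ (EuclideanSpace ℂ (Fin n)) = 2 * n := by
      rw [finrank_real_of_complex, finrank_euclideanSpace_fin]
    have h3 := finrank_tangentSpace x p
    have h4 := (Submodule.equivMapOfInjective _ hinj (tangentSpace x p)).finrank_eq
    omega
  rw [← heq] at hu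
  obtain ⟨w, hw, rfl⟩ := hu
  have h : J (J w) = -w := complexStructure_complexStructure w
  exact h ▸ neg_mem hw

theorem IsProjExtension.apply_complexStructure (hP : IsProjExtension x p P) (hx : IsLagrangian x)
    (v : EuclideanSpace ℂ (Fin n)) :
    P (x.toFun p) (J v) = J v - J (P (x.toFun p) v) := by
  rw [hP.eventually_eq.self_of_nhds]
  refine Submodule.eq_starProjection_of_mem_orthogonal' (z := J ((tangentSpace x p).starProjection v))
    ?_ (hx.complexStructure_mem_orthogonal (Submodule.starProjection_apply_mem _ _)) (by abel)
  rw [← map_sub]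
  exact hx.complexStructure_mem (Submodule.sub_starProjection_mem_orthogonal v)

/-- The derivative of `P J = J (1 - P)`. Together with the self-adjointness of `D_u P` it encodes
the symmetry of `⟨A(u,v), Jw⟩` in `v` and `w`. -/
theorem IsProjExtension.fderiv_complexStructure (hP : IsProjExtension x p P)
    (hPs : ContDiffAt ℝ 1 P (x.toFun p)) (hx : IsLagrangian x)
    {u : EuclideanSpace ℂ (Fin n)} (hu : u ∈ tangentSpace x p) (v : EuclideanSpace ℂ (Fin n)) :
    fderiv ℝ P (x.toFun p) u (J v) = -J (fderiv ℝ P (x.toFun p) u v) := by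
  have hPd := hP.differentiableAt
  have hc : ∀ v, DifferentiableAt ℝ (fun e => P e v) (x.toFun p) := fun v =>
    hPd.clm_apply (differentiableAt_const v)
  have hJ := (complexStructure n).hasFDerivAt.comp (x.toFun p) (hc v).hasFDerivAt
  have h := fderiv_eq_of_eventually_eq x (g := fun e => P e (J v))
    (h := fun e => J v - J (P e v)) (p := p) (by
      filter_upwards [hP.eventually hPs] with q hq
      exact hq.apply_complexStructure hx v) (hc _)
    ((differentiableAt_const _).sub hJ.differentiableAt) hu
  have h2 : fderiv ℝ (fun e => J v - J (P e v)) (x.toFun p) = _ := fderiv_const_sub (J v)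
  rw [h2, neg_apply] at h
  have h3 : fderiv ℝ (fun e => J (P e v)) (x.toFun p) = _ := hJ.fderiv
  rw [h3, ContinuousLinearMap.comp_apply, fderiv_clm_apply_apply hPd (differentiableAt_const _),
    fderiv_clm_apply_apply hPd (differentiableAt_const _)] at h
  simpa using h

end Lagrangian

/-! ### The stability operator on `J∇f` and Hamiltonian variations -/

section Stability

variable {n : ℕ} {M : Type*} [TopologicalSpace M] [ChartedSpace (EuclideanSpace ℝ (Fin n)) M]
  {x : Immersion n M (EuclideanSpace ℂ (Fin n))} {p : M}
  {P : EuclideanSpace ℂ (Fin n) → EuclideanSpace ℂ (Fin n) →L[ℝ] EuclideanSpace ℂ (Fin n)}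
  {f : M → ℝ} {F : EuclideanSpace ℂ (Fin n) → ℝ}
  {G : EuclideanSpace ℂ (Fin n) → EuclideanSpace ℂ (Fin n)} {T : EuclideanSpace ℂ (Fin n)}

local notation "J" => complexStructure _

theorem IsProjExtension.normalConn_JGrad (hP : IsProjExtension x p P) (hx : IsLagrangian x)
    (hfG : ∀ᶠ q in 𝓝 p, (grad x f q : EuclideanSpace ℂ (Fin n)) = G (x.toFun q))
    (hGd : DifferentiableAt ℝ G (x.toFun p)) (u : tangentSpace x p) :
    normalConn x (JGrad x f) p u = J (covDeriv P G (x.toFun p) u) := by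
  have hJ := (complexStructure n).hasFDerivAt.comp (x.toFun p) hGd.hasFDerivAt
  have hV : ∀ᶠ q in 𝓝 p, JGrad x f q = (J ∘ G) (x.toFun q) := by
    filter_upwards [hfG] with q hq
    rw [JGrad, hq]
    rfl
  rw [hP.normalConn_eq hV hJ.differentiableAt, hJ.fderiv, ContinuousLinearMap.comp_apply,
    hP.apply_complexStructure hx, sub_sub_cancel]
  simp only [covDeriv, mul_apply_eq_comp, hP.apply_self u.2]

theorem IsGradExtension.normalHessian_JGrad (hG : IsGradExtension x p F G)
    (hP : IsProjExtension x p P) (hPs : ContDiffAt ℝ 1 P (x.toFun p)) (hx : IsLagrangian x)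
    (hfG : ∀ᶠ q in 𝓝 p, (grad x f q : EuclideanSpace ℂ (Fin n)) = G (x.toFun q))
    (u w : tangentSpace x p) :
    normalHessian x (JGrad x f) p u w =
      J (P (x.toFun p) (fderiv ℝ (covDeriv P G) (x.toFun p) u w)) := by
  have hK := hG.differentiableAt_covDeriv hP
  have hJ := (complexStructure n).hasFDerivAt.comp (x.toFun p)
    (hK.clm_apply (differentiableAt_const (w : EuclideanSpace ℂ (Fin n)))).hasFDerivAt
  have hV : ∀ᶠ q in 𝓝 p, normalConn x (JGrad x f) q (extend x w q) =
      (J ∘ fun e => covDeriv P G e w) (x.toFun q) := by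
    filter_upwards [hG.eventually, hP.eventually hPs, hfG.eventually_nhds,
      hP.eventually_coe_extend w] with q h1 h2 h3 h4
    rw [h2.normalConn_JGrad hx h3 h1.differentiableAt, h4]
    simp only [covDeriv, mul_apply_eq_comp, h2.apply_self (h2.apply_mem _), Function.comp_apply]
  rw [hP.normalHessian_eq hV hJ.differentiableAt, hJ.fderiv, ContinuousLinearMap.comp_apply,
    hP.apply_complexStructure hx, sub_sub_cancel,
    fderiv_clm_apply_apply hK (differentiableAt_const _)]
  simp

/-- The stability operator on `J∇f`. -/
theorem IsGradExtension.stabilityOp_JGrad (hG : IsGradExtension x p F G)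
    (hP : IsProjExtension x p P) (hPs : ContDiffAt ℝ 1 P (x.toFun p)) (hx : IsLagrangian x)
    (hfG : ∀ᶠ q in 𝓝 p, (grad x f q : EuclideanSpace ℂ (Fin n)) = G (x.toFun q)) :
    stabilityOp x T (JGrad x f) p =
      J (P (x.toFun p)
        (∑ i, fderiv ℝ (covDeriv P G) (x.toFun p) (frame x p i) (frame x p i)
          + fderiv ℝ G (x.toFun p) (P (x.toFun p) T)
          + ∑ i, J (fderiv ℝ P (x.toFun p) (frame x p i)
              (J (fderiv ℝ P (x.toFun p) (frame x p i) (G (x.toFun p))))))) := by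
  have hsum : ∀ i, ∑ j, (inner ℝ (secondFF x p (frame x p i) (frame x p j)) (JGrad x f p)) •
      secondFF x p (frame x p i) (frame x p j) =
      J (P (x.toFun p) (J (fderiv ℝ P (x.toFun p) (frame x p i)
              (J (fderiv ℝ P (x.toFun p) (frame x p i) (G (x.toFun p))))))) := by
    intro i
    set u := frame x p i
    set g := G (x.toFun p)
    have hg : g ∈ tangentSpace x p := hG.eventually_mem.self_of_nhds
    have hJmem : J (fderiv ℝ P (x.toFun p) u g) ∈ tangentSpace x p := by
      have h := hP.apply_complexStructure hx (fderiv ℝ P (x.toFun p) u g)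
      rw [hP.apply_fderiv u.2 hg, map_zero, sub_zero] at h
      exact h ▸ hP.apply_mem _
    have hexp : ∑ j, inner ℝ (frame x p j : EuclideanSpace ℂ (Fin n))
        (J (fderiv ℝ P (x.toFun p) u g)) • (frame x p j : EuclideanSpace ℂ (Fin n)) =
        J (fderiv ℝ P (x.toFun p) u g) := by
      simpa using congrArg Subtype.val ((frame x p).sum_repr' ⟨_, hJmem⟩)
    -- Since `⟨A(u,e_j), J∇f⟩ = -⟨e_j, J A(u,∇f)⟩` and `J A(u,∇f)` is tangent, the sum over `j` is a
    -- frame expansion and collapses to `-A(u, J A(u,∇f))`.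
    have hterm : ∀ j, (inner ℝ (secondFF x p u (frame x p j)) (JGrad x f p)) •
        secondFF x p u (frame x p j) =
        -fderiv ℝ P (x.toFun p) u (inner ℝ (frame x p j : EuclideanSpace ℂ (Fin n))
          (J (fderiv ℝ P (x.toFun p) u g)) • (frame x p j : EuclideanSpace ℂ (Fin n))) := by
      intro j
      rw [hP.secondFF_eq, JGrad, hfG.self_of_nhds, ← complexStructure_apply, hP.inner_fderiv u.2,
        hP.fderiv_complexStructure hPs hx u.2, inner_neg_right, map_smul, neg_smul]
    rw [Finset.sum_congr rfl fun j _ => hterm j, Finset.sum_neg_distrib, ← map_sum, hexp,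
      hP.apply_complexStructure hx, hP.apply_fderiv u.2 hJmem, map_zero, sub_zero,
      complexStructure_complexStructure]
  rw [stabilityOp, normalLaplacian, Finset.sum_congr rfl fun i _ => hsum i,
    hP.normalConn_JGrad hx hfG hG.differentiableAt,
    Finset.sum_congr rfl fun i _ => hG.normalHessian_JGrad hP hPs hx hfG _ _]
  simp only [map_add, map_sum, hP.coe_tangential, covDeriv, mul_apply_eq_comp,
    hP.apply_self (hP.apply_mem T)]

theorem stabilityOp_JGrad_eq [IsManifold (𝓡 n) ∞ M] (hx : IsLagrangian x)
    (hT : IsTranslatingSoliton x T) (hf : ContMDiff (𝓡 n) 𝓘(ℝ, ℝ) 3 f) :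
    stabilityOp x T (JGrad x f) = JGrad x (driftLaplacian x T f) := by
  funext p
  -- From `f` of class `C³`, `G` is `C²` and the extended drift Laplacian is `C¹`, just enough to
  -- take its gradient.
  obtain ⟨F, G, hG, hGs, hfG⟩ := exists_isGradExtension x (k := 2) (m := 3) (by norm_num) le_rfl
    (hf p)
  obtain ⟨P, hPs, hP⟩ := exists_isProjExtension x p
  replace hPs : ContDiffAt ℝ 1 P (x.toFun p) := hPs.of_le (by simp)
  have hΛ := hG.eventually_driftLaplacian hP hPs hfG T
  have hΛd : DifferentiableAt ℝ (driftExtension P T G) (x.toFun p) :=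
    (contDiffAt_driftExtension (k := 1) hGs hPs (by norm_num)).differentiableAt (by simp)
  have hg : G (x.toFun p) ∈ tangentSpace x p := hG.eventually_mem.self_of_nhds
  rw [hG.stabilityOp_JGrad hP hPs hx hfG, JGrad, ← complexStructure_apply]
  congr 1
  refine ext_inner_right ℝ fun v => ?_
  rw [← hP.apply_self (grad x (driftLaplacian x T f) p).2, hP.inner_apply, hP.inner_apply]
  set w := P (x.toFun p) v
  have hw : w ∈ tangentSpace x p := hP.apply_mem v
  rw [inner_grad hΛ hΛd hw, fderiv_driftExtension hG hP, inner_add_left, inner_add_left, sum_inner,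
    sum_inner, hG.bochner (frame x p) hP hPs hw]
  -- The two signs, from `J` being skew and from its anticommuting with `D P`, cancel, so this term
  -- is opposite to the Ricci term in `bochner`.
  have hquad : ∀ i, inner ℝ (J (fderiv ℝ P (x.toFun p) (frame x p i)
      (J (fderiv ℝ P (x.toFun p) (frame x p i) (G (x.toFun p)))))) w =
      inner ℝ (fderiv ℝ P (x.toFun p) (frame x p i) (G (x.toFun p)))
        (fderiv ℝ P (x.toFun p) (frame x p i) w) := by
    intro i
    rw [inner_complexStructure_left, hP.inner_fderiv (frame x p i).2,
      hP.fderiv_complexStructure hPs hx (frame x p i).2, inner_neg_right, neg_neg,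
      inner_complexStructure]
  have hH : ∑ i, fderiv ℝ P (x.toFun p) (frame x p i) (frame x p i) =
      T - P (x.toFun p) T := by
    rw [← hP.normalPart_eq, ← hT p, meanCurvature]
    exact Finset.sum_congr rfl fun i _ => (hP.secondFF_eq _ _).symm
  -- Split `D_w G` into `A(w,G)`, which sees only `T^⊥`, and a tangential part, which sees only
  -- `T^⊤` and is rewritten by symmetry of the Hessian.
  have hdrift : inner ℝ T (fderiv ℝ G (x.toFun p) w) =
      inner ℝ (fderiv ℝ P (x.toFun p) w (G (x.toFun p))) (T - P (x.toFun p) T)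
        + inner ℝ (fderiv ℝ G (x.toFun p) (P (x.toFun p) T)) w := by
    rw [hG.inner_fderiv_symm (hP.apply_mem T) hw, inner_sub_right, ← hP.inner_apply _ T,
      hP.apply_fderiv hw hg, inner_zero_left, sub_zero, ← hP.inner_apply,
      real_inner_comm T (P _ _), real_inner_comm T (fderiv ℝ P _ _ _), ← inner_add_right, ← hG.fderiv_eq_add hP hw]
  rw [Finset.sum_congr rfl fun i _ => hquad i, hH, hdrift]
  ring

theorem symplecticForm_JGrad [IsManifold (𝓡 n) ∞ M] (x : Immersion n M (EuclideanSpace ℂ (Fin n)))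
    (hf : ContMDiff (𝓡 n) 𝓘(ℝ, ℝ) ∞ f) (p : M) (v : TangentSpace (𝓡 n) p) :
    symplecticForm (JGrad x f p) (differential x p v) = -dmap f p v := by
  obtain ⟨F, hF, hfF⟩ := exists_local_extension x (k := ⊤) (hf p)
  rw [← inner_grad_differential hfF (hF.differentiableAt (by simp)), symplecticForm, JGrad,
    ← complexStructure_apply, ← complexStructure_apply, complexStructure_complexStructure,
    inner_neg_left]

theorem dmap_neg (f : M → ℝ) (p : M) : dmap (n := n) (-f) p = -dmap f p :=
  mfderiv_neg

theorem JGrad_mem_hamiltonianVariations [IsManifold (𝓡 n) ∞ M] (hx : IsLagrangian x)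
    (hf : ContMDiff (𝓡 n) 𝓘(ℝ, ℝ) ∞ f) : JGrad x f ∈ hamiltonianVariations x := by
  refine ⟨(complexStructure n).contMDiff.comp (contMDiff_grad x hf),
    fun p => hx.complexStructure_mem_orthogonal (grad x f p).2, -f, hf.neg, fun p v => ?_⟩
  rw [symplecticForm_JGrad x hf, dmap_neg]
  rfl

/-- On a Lagrangian submanifold the Hamiltonian variations are the fields `J∇f`. -/
theorem eq_JGrad_of_mem_hamiltonianVariations [IsManifold (𝓡 n) ∞ M] (hx : IsLagrangian x)
    {V : M → EuclideanSpace ℂ (Fin n)} (hV : V ∈ hamiltonianVariations x) :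
    ∃ f : M → ℝ, ContMDiff (𝓡 n) 𝓘(ℝ, ℝ) ∞ f ∧ V = JGrad x f := by
  obtain ⟨-, hVn, h, hh, hhV⟩ := hV
  refine ⟨-h, hh.neg, funext fun p => ?_⟩
  -- The potential is `-h` because `J² = -1`. The difference is normal, so `J` of it is tangent; it
  -- is also orthogonal to the tangent space because both fields induce the same one-form.
  have hJ : J (V p - JGrad x (-h) p) = 0 := by
    have hmem : J (V p - JGrad x (-h) p) ∈ tangentSpace x p :=
      hx.complexStructure_mem (sub_mem (hVn p) (hx.complexStructure_mem_orthogonal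
        (grad x (-h) p).2))
    have horth : J (V p - JGrad x (-h) p) ∈ (tangentSpace x p)ᗮ := by
      rw [Submodule.mem_orthogonal']
      rintro _ ⟨v, rfl⟩
      have h1 := hhV p v
      have h2 := symplecticForm_JGrad (f := -h) x hh.neg p v
      rw [dmap_neg] at h2
      simp only [symplecticForm, ← complexStructure_apply] at h1 h2
      rw [map_sub, inner_sub_left]
      refine sub_eq_zero.mpr (h1.trans (Eq.trans ?_ h2.symm))
      exact (neg_neg _).symm
    exact Submodule.disjoint_def.mp (tangentSpace x p).orthogonal_disjoint _ hmem horth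
  have h3 := congrArg (J : EuclideanSpace ℂ (Fin n) → _) hJ
  rw [complexStructure_complexStructure, map_zero, neg_eq_zero, sub_eq_zero] at h3
  exact h3

end Stability

end Soliton

theorem theorem3p1 {n : ℕ} {M : Type*} [TopologicalSpace M]
    [ChartedSpace (EuclideanSpace ℝ (Fin n)) M] [IsManifold (𝓡 n) ∞ M]
    (x : Soliton.Immersion n M (EuclideanSpace ℂ (Fin n))) (T : EuclideanSpace ℂ (Fin n))
    (hx : Soliton.IsLagrangian x) (hT : Soliton.IsTranslatingSoliton x T) :
    (∀ f : M → ℝ, ContMDiff (𝓡 n) 𝓘(ℝ, ℝ) 3 f →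
      Soliton.stabilityOp x T (Soliton.JGrad x f)
        = Soliton.JGrad x (Soliton.driftLaplacian x T f)) ∧
    (∀ V ∈ Soliton.hamiltonianVariations x,
      Soliton.stabilityOp x T V ∈ Soliton.hamiltonianVariations x) := by
  refine ⟨fun f hf => Soliton.stabilityOp_JGrad_eq hx hT hf, fun V hV => ?_⟩
  obtain ⟨f, hf, rfl⟩ := Soliton.eq_JGrad_of_mem_hamiltonianVariations hx hV
  rw [Soliton.stabilityOp_JGrad_eq hx hT (hf.of_le ENat.LEInfty.out)]
  exact Soliton.JGrad_mem_hamiltonianVariations hx (Soliton.contMDiff_driftLaplacian x T hf)
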